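/- Consider a clustered distributed storage system in which $n$ nodes are divided into $L$ clusters of $n_I=n/L\ge 2$ nodes each, every node stores $\alpha$ symbols, and a data collector contacts an arbitrary set of $k<n$ nodes. A failed node is repaired by all $n-1$ other nodes: each node of the same cluster sends $\beta_I>0$ symbols and each node of another cluster sends $\beta_c$ symbols, where $0\le\beta_c\le\beta_I$. Put $\epsilon=\beta_c/\beta_I$ and $\gamma=(n_I-1)\beta_I+(n-n_I)\beta_c$ (the repair bandwidth). The capacity $\mathcal C(\alpha,\beta_I,\beta_c)$ is the maximum amount of data retrievable from any $k$ nodes after any sequence of failures and repairs, i.e. the minimum, over all information flow graphs of the system, of the min-cut between the source and the data collector. For given $\epsilon$ it is a function $\mathcal C(\alpha,\gamma)$ of $(\alpha,\gamma)$. For a file size $\mathcal M>0$, the minimum-storage-regenerating (MSR) point for $\epsilon$ is, among the points $(\alpha,\gamma)$ with $\mathcal C(\alpha,\gamma)=\mathcal M$ that have the minimum $\alpha$, the one with the smallest $\gamma$. Let $q=\lfloor k/n_I\rfloor$ and assume $k\ge n_I-1$ (in particular, this covers every case with $q\ge 1$). Then for $\epsilon=0$ the MSR point exists, is unique, and equals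 $$(\alpha,\gamma)=\left(\frac{\mathcal M}{k-q},\ \frac{\mathcal M}{k-q}\,(n_I-1)\right).$$ Moreover, at this point $\alpha=\beta_I$. -/

import Mathlib

open scoped ENNReal

namespace ClusteredDSS

/-- The storage nodes: `N(l, j)` is the `j`-th node of the `l`-th of `L` clusters of `n_I` nodes. -/
abbrev Node (n_I L : ℕ) : Type := Fin L × Fin n_I

/-- Over a history of `T` failures, the successive contents of the nodes: the initially stored
content of each node, and, for each `t`, the content of the newcomer that replaces the node lost in
the `t`-th failure. -/
abbrev Incarnation (n_I L T : ℕ) : Type := Node n_I L ⊕ Fin T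

/-- The node at which an incarnation lives, when the `t`-th node to fail is `fail t`. -/
def location {n_I L T : ℕ} (fail : Fin T → Node n_I L) : Incarnation n_I L T → Node n_I L
  | Sum.inl x => x
  | Sum.inr t => fail t

/-- The incarnation exists, and is still alive, just before the failure number `t`
(failures are numbered from `0`; for `t = T`, after all the failures). -/
def IsActive {n_I L T : ℕ} (fail : Fin T → Node n_I L) (t : ℕ) : Incarnation n_I L T → Prop
  | Sum.inl x => ∀ s : Fin T, (s : ℕ) < t → fail s ≠ x
  | Sum.inr s₀ => (s₀ : ℕ) < t ∧ ∀ s : Fin T, s₀ < s → (s : ℕ) < t → fail s ≠ fail s₀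

/-- Vertices of the information flow graph: the source, an input and an output vertex for each
incarnation of a node, and the data collector (the sink). -/
inductive FlowVertex (n_I L T : ℕ) : Type
  | source : FlowVertex n_I L T
  | inp : Incarnation n_I L T → FlowVertex n_I L T
  | out : Incarnation n_I L T → FlowVertex n_I L T
  | sink : FlowVertex n_I L T
  deriving DecidableEq, Fintype

open Classical in
/-- Edge capacities of the information flow graph (`0` means that there is no edge).
* The source feeds the initial nodes without restriction.
* Each node stores `α` symbols.
* The newcomer at the failure number `t` receives, from every one of the `n - 1` surviving nodes,
  `β_I` symbols if the helper is in the same cluster and `β_c` symbols otherwise.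
* The data collector reads everything stored by the nodes in `A`, after the last failure. -/
noncomputable def edgeCapacity {n_I L T : ℕ} (α β_I β_c : ℝ) (fail : Fin T → Node n_I L)
    (A : Finset (Node n_I L)) : FlowVertex n_I L T → FlowVertex n_I L T → ℝ≥0∞
  | .source, .inp (Sum.inl _) => ⊤
  | .inp i, .out j => if i = j then ENNReal.ofReal α else 0
  | .out i, .inp (Sum.inr t) =>
      if IsActive fail t i ∧ location fail i ≠ fail t then
        if (location fail i).1 = (fail t).1 then ENNReal.ofReal β_I else ENNReal.ofReal β_c
      else 0
  | .out i, .sink => if IsActive fail T i ∧ location fail i ∈ A then ⊤ else 0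
  | _, _ => 0

/-- The minimum, over all cuts `U` separating `s` from `t`, of the total capacity of the edges that
leave `U`. -/
noncomputable def minCut {V : Type} [Fintype V] [DecidableEq V] (c : V → V → ℝ≥0∞) (s t : V) :
    ℝ≥0∞ :=
  ⨅ (U : Finset V) (_ : s ∈ U) (_ : t ∉ U), ∑ u ∈ U, ∑ v ∈ Uᶜ, c u v

/-- The capacity `C(α, β_I, β_c)`: the maximum amount of data that can be retrieved by contacting
arbitrary `k` nodes after an arbitrary history of failures and repairs, that is, the smallest
min-cut between the source and a data collector over all information flow graphs. -/
noncomputable def capacity (n_I L k : ℕ) (α β_I β_c : ℝ) : ℝ≥0∞ :=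
  ⨅ (T : ℕ) (fail : Fin T → Node n_I L) (A : Finset (Node n_I L)) (_ : A.card = k),
    minCut (edgeCapacity α β_I β_c fail A) FlowVertex.source FlowVertex.sink

/-- The repair bandwidth `γ = (n_I - 1) β_I + (n - n_I) β_c`, where `n = n_I L`. -/
def repairBandwidth (n_I L : ℕ) (β_I β_c : ℝ) : ℝ :=
  ((n_I : ℝ) - 1) * β_I + (((n_I * L : ℕ) : ℝ) - n_I) * β_c

/-- The system with node storage `α` and per-helper repair bandwidths `β_I ≥ β_c` has
`β_c / β_I = ε` and repair bandwidth `γ`, and its capacity is the file size `M`. -/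
structure IsRealization (n_I L k : ℕ) (M ε α γ β_I β_c : ℝ) : Prop where
  storage_nonneg : 0 ≤ α
  intra_pos : 0 < β_I
  cross_nonneg : 0 ≤ β_c
  cross_le_intra : β_c ≤ β_I
  ratio_eq : ε = β_c / β_I
  bandwidth_eq : γ = repairBandwidth n_I L β_I β_c
  capacity_eq : capacity n_I L k α β_I β_c = ENNReal.ofReal M

/-- The point `(α, γ)` satisfies `C(α, γ) = M` for the given ratio `ε`. -/
def IsFeasiblePoint (n_I L k : ℕ) (M ε α γ : ℝ) : Prop :=
  ∃ β_I β_c : ℝ, IsRealization n_I L k M ε α γ β_I β_c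

/-- The minimum-storage-regenerating point for the ratio `ε`: among the feasible points with the
minimum node capacity `α`, the one with the smallest repair bandwidth `γ`. -/
structure IsMSRPoint (n_I L k : ℕ) (M ε α γ : ℝ) : Prop where
  feasible : IsFeasiblePoint n_I L k M ε α γ
  storage_min : ∀ α' γ' : ℝ, IsFeasiblePoint n_I L k M ε α' γ' → α ≤ α'
  bandwidth_min : ∀ γ' : ℝ, IsFeasiblePoint n_I L k M ε α γ' → γ ≤ γ'

end ClusteredDSS

/-! With `β_c = 0` only helpers in the same cluster matter. Put `d = k - k / n_I`. Upper bound: let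
the first `k` nodes fail in lexicographic order and be read. Newcomer `t` gets fresh data only from
the `n_I - 1 - t % n_I` cluster mates that have not yet failed, so it adds at most `min α ((n_I - 1
- t % n_I) β_I)`. The last node of each full cluster adds nothing, and newcomer `n_I - 2` has one
fresh helper. Hence `M ≤ d α` and `M ≤ β_I + (d - 1) α`. Lower bound: if `β_I = α`, every cut is
worth at least `d α` (`le_capacity_self`), by a count cluster by cluster. So the least storage is `M
/ d`, and there the second inequality forces `β_I ≥ α`, which `β_I = α` attains. -/

namespace ClusteredDSS

/-! ### Cut sums split by type of vertex. -/

section FlowVertexSums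

variable {n_I L T : ℕ}

/-- The vertices of the information flow graph as a disjoint union. -/
def FlowVertex.equivSum (n_I L T : ℕ) : FlowVertex n_I L T ≃
    (Unit ⊕ Unit) ⊕ (Incarnation n_I L T ⊕ Incarnation n_I L T) where
  toFun
    | .source => .inl (.inl ())
    | .sink => .inl (.inr ())
    | .inp i => .inr (.inl i)
    | .out i => .inr (.inr i)
  invFun
    | .inl (.inl ()) => .source
    | .inl (.inr ()) => .sink
    | .inr (.inl i) => .inp i
    | .inr (.inr i) => .out i
  left_inv v := by cases v <;> rfl
  right_inv v := by rcases v with (_ | _) | (_ | _) <;> rfl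

theorem sum_flowVertex {R : Type*} [AddCommMonoid R] (f : FlowVertex n_I L T → R) :
    ∑ v, f v = f .source + f .sink + (∑ i, f (.inp i) + ∑ i, f (.out i)) := by
  rw [← (FlowVertex.equivSum n_I L T).symm.sum_comp f]
  simp [Fintype.sum_sum_type, FlowVertex.equivSum]

theorem sum_cut {V : Type} [Fintype V] [DecidableEq V] (c : V → V → ℝ≥0∞) (U : Finset V) :
    ∑ u ∈ U, ∑ v ∈ Uᶜ, c u v = ∑ u, ∑ v, if u ∈ U ∧ v ∉ U then c u v else 0 := by
  rw [← Finset.sum_filter_add_sum_filter_not Finset.univ (· ∈ U)]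
  rw [Finset.sum_eq_zero (s := Finset.univ.filter (· ∉ U)), add_zero]
  · simp only [Finset.filter_univ_mem]
    refine Finset.sum_congr rfl fun u hu => ?_
    rw [← Finset.sum_filter]
    refine Finset.sum_congr ?_ fun _ _ => rfl
    ext v
    simp [hu]
  · intro u hu
    simp_all

end FlowVertexSums

/-! ### Upper bounds on the capacity from one failure history. -/

section UpperBound

variable {n_I L k : ℕ}

/-- The history in which the first `k` nodes, in lexicographic order, fail one after the other. -/
def lexFailures (n_I L k : ℕ) (h0 : 0 < n_I) (hk : k ≤ n_I * L) (t : Fin k) : Node n_I L :=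
  (⟨t / n_I, Nat.div_lt_of_lt_mul (t.2.trans_le hk)⟩, ⟨t % n_I, Nat.mod_lt _ h0⟩)

theorem lexFailures_injective (h0 : 0 < n_I) (hk : k ≤ n_I * L) :
    Function.Injective (lexFailures n_I L k h0 hk) := by
  intro s t h
  simp only [lexFailures, Prod.mk.injEq, Fin.mk.injEq] at h
  ext
  rw [← Nat.div_add_mod s n_I, ← Nat.div_add_mod t n_I, h.1, h.2]

/-- The vertices on the source side of the cut which separates the newcomer `t` from its helpers if
`t ∈ S`, and its output from its input otherwise. -/
def SourceSide {T : ℕ} (S : Set (Fin T)) : FlowVertex n_I L T → Prop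
  | .source => True
  | .inp (.inl _) => True
  | .inp (.inr t) => t ∉ S
  | .out (.inl _) => True
  | .out (.inr _) => False
  | .sink => False

/-- In lexicographic order, the cluster mates of smaller index have already failed, so an untouched
helper has index in `(t % n_I, n_I)`. -/
theorem card_later_le (h0 : 0 < n_I) (hk : k ≤ n_I * L) (t : Fin k) (s : Finset (Node n_I L))
    (hs : ∀ x ∈ s, IsActive (lexFailures n_I L k h0 hk) t (Sum.inl x) ∧
      x ≠ lexFailures n_I L k h0 hk t ∧ x.1 = (lexFailures n_I L k h0 hk t).1) :
    s.card ≤ n_I - 1 - t % n_I := by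
  have : n_I - 1 - t % n_I = (Finset.Ioo ((t : ℕ) % n_I) n_I).card := by
    rw [Nat.card_Ioo]; omega
  rw [this]
  refine Finset.card_le_card_of_injOn (fun x => (x.2 : ℕ)) ?_ ?_
  · intro x hx
    obtain ⟨h1, h2, h3⟩ := hs x hx
    simp only [Finset.coe_Ioo, Set.mem_Ioo, x.2.2, and_true]
    by_contra! hlt
    have hx1 : (x.1 : ℕ) = t / n_I := by rw [h3]; rfl
    have hdm := Nat.div_add_mod (t : ℕ) n_I
    rcases hlt.lt_or_eq with hlt | heq
    · have hst : n_I * (t / n_I) + x.2 < t := by omega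
      refine h1 ⟨n_I * (t / n_I) + x.2, hst.trans t.2⟩ hst ?_
      ext
      · simp [lexFailures, hx1, Nat.mul_add_div h0, Nat.div_eq_of_lt x.2.2]
      · simp [lexFailures, Nat.mod_eq_of_lt x.2.2]
    · exact h2 (Prod.ext h3 (Fin.ext heq))
  · intro x hx y hy hxy
    exact Prod.ext ((hs x hx).2.2.trans (hs y hy).2.2.symm) (Fin.ext hxy)

theorem capacity_le_cut {T : ℕ} (α β_I β_c : ℝ) (fail : Fin T → Node n_I L)
    {A : Finset (Node n_I L)} (hA : A.card = k) {U : Finset (FlowVertex n_I L T)}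
    (hsource : .source ∈ U) (hsink : .sink ∉ U) :
    capacity n_I L k α β_I β_c ≤
      ∑ u ∈ U, ∑ v ∈ Uᶜ, edgeCapacity α β_I β_c fail A u v := by
  unfold capacity minCut
  exact iInf_le_of_le T <| iInf_le_of_le fail <| iInf_le_of_le A <| iInf_le_of_le hA <|
    iInf_le_of_le U <| iInf_le_of_le hsource <| iInf_le_of_le hsink le_rfl

theorem capacity_le_sum_min (h0 : 0 < n_I) (hk : k ≤ n_I * L) (α β : ℝ) :
    capacity n_I L k α β 0 ≤ ∑ t ∈ Finset.range k,
      min (ENNReal.ofReal α) (((n_I - 1 - t % n_I : ℕ) : ℝ≥0∞) * ENNReal.ofReal β) := by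
  classical
  obtain ⟨fail, hfail⟩ : ∃ f, f = lexFailures n_I L k h0 hk := ⟨_, rfl⟩
  obtain ⟨A, hA⟩ : ∃ A, A = Finset.univ.image fail := ⟨_, rfl⟩
  have hcard : A.card = k := by
    rw [hA, hfail, Finset.card_image_of_injective _ (lexFailures_injective h0 hk), Finset.card_fin]
  -- `S` collects the newcomers for which cutting the repair edges is no dearer than cutting the
  -- storage edge.
  obtain ⟨S, hS⟩ : ∃ S : Set (Fin k), ∀ t, t ∈ S ↔
    ((n_I - 1 - t % n_I : ℕ) : ℝ≥0∞) * ENNReal.ofReal β ≤ ENNReal.ofReal α := ⟨{t | _}, fun _ => Iff.rfl⟩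
  obtain ⟨U, hUmem⟩ : ∃ U : Finset (FlowVertex n_I L k), ∀ v, v ∈ U ↔ SourceSide S v :=
    ⟨Finset.univ.filter (SourceSide S), by simp⟩
  refine (capacity_le_cut α β 0 fail hcard (U := U) ((hUmem _).2 trivial)
    (fun h => (hUmem _).1 h)).trans ?_
  rw [sum_cut, Finset.sum_comm, sum_flowVertex, ← Fin.sum_univ_eq_sum_range
    (fun t => min (ENNReal.ofReal α) (((n_I - 1 - t % n_I : ℕ) : ℝ≥0∞) * ENNReal.ofReal β))]
  simp only [Fintype.sum_sum_type, hUmem, sum_flowVertex]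
  simp only [SourceSide]
  simp only [edgeCapacity]
  -- Every node that is read has failed, so no infinite edge from an initial node to the sink is
  -- cut.
  have hsink : ∀ x : Node n_I L, ¬ (IsActive fail k (Sum.inl x) ∧ location fail (Sum.inl x) ∈ A) := by
    rintro x ⟨h1, h2⟩
    obtain ⟨s, -, hs⟩ := Finset.mem_image.1 (hA ▸ h2)
    exact h1 s s.2 hs
  simp only [hsink]
  simp only [not_true_eq_false, and_false, if_false, false_and, not_false_eq_true, and_true,
    true_and, Finset.sum_const_zero, add_zero, zero_add, reduceCtorEq, not_not, ite_self,
    Sum.inr.injEq, ← Finset.sum_add_distrib]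
  refine Finset.sum_le_sum fun t _ => ?_
  by_cases ht : t ∈ S
  · rw [min_eq_right ((hS t).1 ht), Finset.sum_eq_zero (s := (Finset.univ : Finset (Fin k))),
      add_zero]
    · simp only [ht, ← ite_and, ENNReal.ofReal_zero]
      rw [← Finset.sum_filter, Finset.sum_const, nsmul_eq_mul]
      gcongr
      refine card_later_le h0 hk t _ fun x hx => ?_
      simp only [Finset.mem_filter, Finset.mem_univ, true_and, hfail] at hx
      exact ⟨hx.1.1, hx.1.2, hx.2⟩
    · intro s _
      rw [← ite_and, if_neg]
      rintro ⟨h1, rfl⟩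
      exact h1 ht
  · rw [min_eq_left (not_le.1 (mt (hS t).2 ht)).le]
    rw [Finset.sum_eq_single_of_mem t (Finset.mem_univ t)]
    · simp [ht]
    · intro s _ hs
      simp [hs]

theorem card_filter_not_dvd_succ (m k : ℕ) :
    ((Finset.range k).filter fun t => ¬ m ∣ t + 1).card = k - k / m := by
  induction k with
  | zero => simp
  | succ k ih =>
    rw [Finset.range_add_one, Finset.filter_insert, Nat.succ_div]
    have := Nat.div_le_self k m
    split_ifs
    · rw [ih]; omega
    · rw [Finset.card_insert_of_notMem (by simp), ih]; omega

theorem capacity_le_sum_not_dvd (h0 : 0 < n_I) (hk : k ≤ n_I * L) (α β : ℝ) :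
    capacity n_I L k α β 0 ≤ ∑ t ∈ Finset.range k with ¬ n_I ∣ t + 1,
      min (ENNReal.ofReal α) (((n_I - 1 - t % n_I : ℕ) : ℝ≥0∞) * ENNReal.ofReal β) := by
  refine (capacity_le_sum_min h0 hk α β).trans_eq ?_
  rw [← Finset.sum_filter_add_sum_filter_not (Finset.range k) (fun t => n_I ∣ t + 1),
    Finset.sum_eq_zero, zero_add]
  intro t ht
  obtain ⟨c, hc⟩ := (Finset.mem_filter.1 ht).2
  have hmod : t % n_I = n_I - 1 := by
    obtain ⟨d, rfl⟩ : ∃ d, c = d + 1 := ⟨c - 1, by rcases c with _ | c <;> simp_all⟩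
    have ht : t = n_I - 1 + n_I * d := by rw [mul_add] at hc; omega
    rw [ht, Nat.add_mul_mod_self_left, Nat.mod_eq_of_lt (by omega)]
  simp [hmod]

theorem capacity_le_card_mul (h0 : 0 < n_I) (hk : k ≤ n_I * L) (α β : ℝ) :
    capacity n_I L k α β 0 ≤ ((k - k / n_I : ℕ) : ℝ≥0∞) * ENNReal.ofReal α := by
  refine (capacity_le_sum_not_dvd h0 hk α β).trans ?_
  rw [← card_filter_not_dvd_succ, ← nsmul_eq_mul]
  exact Finset.sum_le_card_nsmul _ _ _ fun t _ => min_le_left _ _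

theorem capacity_le_card_mul_add (h0 : 2 ≤ n_I) (hk : k ≤ n_I * L) (hk' : n_I ≤ k + 1) (α β : ℝ) :
    capacity n_I L k α β 0 ≤
      ENNReal.ofReal β + ((k - k / n_I - 1 : ℕ) : ℝ≥0∞) * ENNReal.ofReal α := by
  refine (capacity_le_sum_not_dvd (by omega) hk α β).trans ?_
  -- Newcomer `n_I - 2` has exactly one fresh helper; it occurs in the history because `n_I - 1 ≤
  -- k`.
  have hmem : n_I - 2 ∈ (Finset.range k).filter fun t => ¬ n_I ∣ t + 1 := by
    simp only [Finset.mem_filter, Finset.mem_range]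
    exact ⟨by omega, fun h => by have := Nat.le_of_dvd (by omega) h; omega⟩
  rw [← Finset.add_sum_erase _ _ hmem, ← card_filter_not_dvd_succ, ← Finset.card_erase_of_mem hmem]
  refine add_le_add ((min_le_right _ _).trans_eq ?_)
    ((Finset.sum_le_card_nsmul _ _ _ fun t _ => min_le_left _ _).trans_eq (nsmul_eq_mul _ _))
  rw [Nat.mod_eq_of_lt (by omega), show n_I - 1 - (n_I - 2) = 1 by omega, Nat.cast_one, one_mul]

end UpperBound

/-! ### Lower bound on every cut when `β_I = α`. -/

section LowerBound

variable {n_I L T : ℕ}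

theorem card_filter_cluster (l : Fin L) :
    (Finset.univ.filter fun x : Node n_I L => x.1 = l).card = n_I := by
  have : (Finset.univ.filter fun x : Node n_I L => x.1 = l) = {l} ×ˢ Finset.univ := by
    ext ⟨l', j⟩
    simp [eq_comm]
  rw [this, Finset.card_product, Finset.card_singleton, Finset.card_fin, one_mul]

theorem exists_isActive_location (fail : Fin T → Node n_I L) (t : ℕ) (x : Node n_I L) :
    ∃ i, IsActive fail t i ∧ location fail i = x := by
  classical
  by_cases h : ∃ s : Fin T, (s : ℕ) < t ∧ fail s = x
  · obtain ⟨s, hs, hmax⟩ := Finset.exists_max_image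
      (Finset.univ.filter fun s : Fin T => (s : ℕ) < t ∧ fail s = x) id
      (by obtain ⟨s, hs⟩ := h; exact ⟨s, by simpa using hs⟩)
    simp only [Finset.mem_filter, Finset.mem_univ, true_and, id] at hs hmax
    refine ⟨Sum.inr s, ⟨hs.1, fun r hsr hr heq => ?_⟩, hs.2⟩
    exact absurd (hmax r ⟨hr, heq.trans hs.2⟩) (not_le.2 hsr)
  · exact ⟨Sum.inl x, fun s hs heq => h ⟨s, hs, heq⟩, rfl⟩

/-- Capping at `m - 1` loses one node per full cluster, and at most `k / m` clusters can be full. -/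
theorem card_sub_div_le_sum_min_card {m k : ℕ} (a : Fin L → ℕ) (ha : ∀ l, a l ≤ m) (hm : 0 < m)
    (hsum : ∑ l, a l = k) : k - k / m ≤ ∑ l, min (a l) (m - 1) := by
  have h1 : k ≤ ∑ l, min (a l) (m - 1) + (Finset.univ.filter fun l => a l = m).card := by
    rw [Finset.card_filter, ← Finset.sum_add_distrib, ← hsum]
    refine Finset.sum_le_sum fun l _ => ?_
    have := ha l
    split_ifs <;> omega
  have h2 : (Finset.univ.filter fun l => a l = m).card ≤ k / m := by
    rw [Nat.le_div_iff_mul_le hm, ← smul_eq_mul, ← Finset.sum_const, ← hsum]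
    calc _ ≤ ∑ l ∈ Finset.univ.filter (fun l => a l = m), a l :=
          Finset.sum_le_sum fun l hl => (Finset.mem_filter.1 hl).2.ge
      _ ≤ _ := Finset.sum_le_sum_of_subset (Finset.subset_univ _)
  omega

theorem le_sum_cut {V : Type} [Fintype V] [DecidableEq V] (c : V → V → ℝ≥0∞) {U : Finset V}
    {u v : V} (hu : u ∈ U) (hv : v ∉ U) : c u v ≤ ∑ u ∈ U, ∑ v ∈ Uᶜ, c u v :=
  (Finset.single_le_sum (f := fun v => c u v) (fun _ _ => zero_le) (Finset.mem_compl.2 hv)).trans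
    (Finset.single_le_sum (f := fun u => ∑ v ∈ Uᶜ, c u v) (fun _ _ => zero_le) hu)

open Classical in
/-- The part of the capacity of a cut that is due to the storage edge of the incarnation `i`, and to
the repair edges that leave `i`. -/
noncomputable def incarnationCut (c : FlowVertex n_I L T → FlowVertex n_I L T → ℝ≥0∞)
    (U : Finset (FlowVertex n_I L T)) (i : Incarnation n_I L T) : ℝ≥0∞ :=
  (if .inp i ∈ U ∧ .out i ∉ U then c (.inp i) (.out i) else 0) +
    ∑ j, if .out i ∈ U ∧ .inp j ∉ U then c (.out i) (.inp j) else 0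

theorem sum_incarnationCut_le (c : FlowVertex n_I L T → FlowVertex n_I L T → ℝ≥0∞)
    (U : Finset (FlowVertex n_I L T)) :
    ∑ i, incarnationCut c U i ≤ ∑ u ∈ U, ∑ v ∈ Uᶜ, c u v := by
  classical
  rw [sum_cut, sum_flowVertex]
  refine le_trans ?_ le_add_self
  simp only [incarnationCut, Finset.sum_add_distrib]
  refine add_le_add (Finset.sum_le_sum fun i _ => ?_) (Finset.sum_le_sum fun i _ => ?_)
  · convert Finset.single_le_sum (f := fun v => if .inp i ∈ U ∧ v ∉ U then c (.inp i) v else 0)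
      (fun _ _ => zero_le) (Finset.mem_univ (.out i))
  · rw [sum_flowVertex]
    refine le_trans ?_ le_add_self
    refine le_trans ?_ le_self_add
    exact Finset.sum_le_sum fun j _ => by convert le_rfl

/-- At any time each node has an active incarnation, and distinct nodes have distinct ones, so their
contributions add up. -/
theorem card_mul_le_sum_incarnationCut (c : FlowVertex n_I L T → FlowVertex n_I L T → ℝ≥0∞)
    (U : Finset (FlowVertex n_I L T)) (fail : Fin T → Node n_I L) (t : ℕ) (l : Fin L)
    (s : Finset (Node n_I L)) (hs : ∀ x ∈ s, x.1 = l) (a : ℝ≥0∞)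
    (h : ∀ i, IsActive fail t i → location fail i ∈ s → a ≤ incarnationCut c U i) :
    s.card * a ≤ ∑ i with (location fail i).1 = l, incarnationCut c U i := by
  classical
  choose cur hact hloc using exists_isActive_location fail t
  have hinj : Function.Injective cur := Function.LeftInverse.injective hloc
  calc s.card * a = ∑ x ∈ s, a := by rw [Finset.sum_const, nsmul_eq_mul]
    _ ≤ ∑ x ∈ s, incarnationCut c U (cur x) :=
        Finset.sum_le_sum fun x hx => h _ (hact x) (by rwa [hloc])
    _ = ∑ i ∈ s.image cur, incarnationCut c U i := by
        rw [Finset.sum_image fun x _ y _ h => hinj h]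
    _ ≤ _ := Finset.sum_le_sum_of_subset fun i hi => by
        obtain ⟨x, hx, rfl⟩ := Finset.mem_image.1 hi
        simp [hloc, hs x hx]

/-- Take the first newcomer of the cluster lying wholly on the sink side, if any: each of its `n_I -
1` cluster helpers costs `α`, by a repair edge or, by minimality, by its own storage edge. If there
is none, each node read in the cluster has its storage edge cut. -/
theorem min_card_mul_le_sum_incarnationCut (α : ℝ) (fail : Fin T → Node n_I L)
    (A : Finset (Node n_I L)) (U : Finset (FlowVertex n_I L T))
    (hin : ∀ x, .inp (.inl x) ∈ U)
    (hout : ∀ i, IsActive fail T i → location fail i ∈ A → .out i ∉ U) (l : Fin L) :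
    (min (A.filter fun x => x.1 = l).card (n_I - 1) : ℕ) * ENNReal.ofReal α ≤
      ∑ i with (location fail i).1 = l, incarnationCut (edgeCapacity α α 0 fail A) U i := by
  classical
  have hstore : ∀ i, .inp i ∈ U → .out i ∉ U →
      ENNReal.ofReal α ≤ incarnationCut (edgeCapacity α α 0 fail A) U i := by
    intro i h1 h2
    refine le_trans ?_ le_self_add
    simp [h1, h2, edgeCapacity]
  by_cases hW : ∃ t : Fin T, (fail t).1 = l ∧ .inp (.inr t) ∉ U ∧ .out (.inr t) ∉ U
  · obtain ⟨t, ht, hmin⟩ := Finset.exists_min_image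
      (Finset.univ.filter fun t : Fin T =>
        (fail t).1 = l ∧ .inp (.inr t) ∉ U ∧ .out (.inr t) ∉ U) id
      (by obtain ⟨s, hs⟩ := hW; exact ⟨s, by simpa using hs⟩)
    simp only [Finset.mem_filter, Finset.mem_univ, true_and, id] at ht hmin
    obtain ⟨htl, hti, hto⟩ := ht
    have hcard : ((Finset.univ.filter fun x : Node n_I L => x.1 = l).erase (fail t)).card
        = n_I - 1 := by
      rw [Finset.card_erase_of_mem (by simp [htl])]
      rw [card_filter_cluster]
    refine le_trans ?_ (card_mul_le_sum_incarnationCut _ U fail t l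
      ((Finset.univ.filter fun x : Node n_I L => x.1 = l).erase (fail t)) (by simp)
      (ENNReal.ofReal α) ?_)
    · rw [hcard]
      gcongr
      exact min_le_right _ _
    · intro i hact hloc
      simp only [Finset.mem_erase, Finset.mem_filter, Finset.mem_univ, true_and] at hloc
      by_cases ho : .out i ∈ U
      · refine le_trans ?_ le_add_self
        refine le_trans ?_ (Finset.single_le_sum (fun _ _ => zero_le)
          (Finset.mem_univ (Sum.inr t)))
        simp [ho, hti, edgeCapacity, hact, hloc, htl]
      · refine hstore i ?_ ho
        rcases i with x | s
        · exact hin x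
        · by_contra hi
          exact absurd (hmin s ⟨hloc.2, hi, ho⟩) (not_le.2 hact.1)
  · push Not at hW
    refine le_trans ?_ (card_mul_le_sum_incarnationCut _ U fail T l
      (A.filter fun x => x.1 = l) (by simp) (ENNReal.ofReal α) ?_)
    · gcongr
      exact min_le_left _ _
    · intro i hact hloc
      rw [Finset.mem_filter] at hloc
      have ho := hout i hact hloc.1
      refine hstore i ?_ ho
      rcases i with x | s
      · exact hin x
      · by_contra hi
        exact ho (hW s hloc.2 hi)

theorem le_capacity_self {k : ℕ} (h0 : 0 < n_I) (α : ℝ) :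
    ((k - k / n_I : ℕ) : ℝ≥0∞) * ENNReal.ofReal α ≤ capacity n_I L k α α 0 := by
  classical
  unfold capacity minCut
  refine le_iInf fun T => le_iInf fun fail => le_iInf fun A => le_iInf fun hA => le_iInf fun U =>
    le_iInf fun hsource => le_iInf fun hsink => ?_
  -- A cut of finite value keeps the initial inputs on the source side and the outputs that are read
  -- on the sink side.
  by_cases htop : ∃ u ∈ U, ∃ v ∉ U, edgeCapacity α α 0 fail A u v = ⊤
  · obtain ⟨u, hu, v, hv, h⟩ := htop
    exact le_top.trans (h.symm.le.trans (le_sum_cut _ hu hv))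
  push Not at htop
  have hin : ∀ x, .inp (.inl x) ∈ U := fun x => by
    by_contra h
    exact htop _ hsource _ h rfl
  have hout : ∀ i, IsActive fail T i → location fail i ∈ A → .out i ∉ U := fun i h1 h2 h => by
    exact htop _ h _ hsink (if_pos ⟨h1, h2⟩)
  refine le_trans ?_ (sum_incarnationCut_le _ U)
  rw [← Finset.sum_fiberwise (s := Finset.univ) (g := fun i => (location fail i).1)]
  refine le_trans ?_ (Finset.sum_le_sum fun l _ =>
    min_card_mul_le_sum_incarnationCut α fail A U hin hout l)
  rw [← Finset.sum_mul, ← Nat.cast_sum]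
  gcongr
  refine card_sub_div_le_sum_min_card _ (fun l => ?_) h0 ?_
  · exact (Finset.card_le_card (Finset.filter_subset_filter _ (Finset.subset_univ _))).trans_eq
      (card_filter_cluster l)
  · rw [← hA]
    exact (Finset.card_eq_sum_card_fiberwise fun _ _ => Finset.mem_univ _).symm

end LowerBound

/-! ### Identification of the MSR point. -/

section MSR

variable {n_I L k : ℕ} {M α γ β_I β_c : ℝ}

theorem IsRealization.cross_eq_zero (h : IsRealization n_I L k M 0 α γ β_I β_c) : β_c = 0 := by
  have := h.ratio_eq
  rw [eq_comm, div_eq_zero_iff] at this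
  exact this.resolve_right h.intra_pos.ne'

theorem IsRealization.bandwidth_eq_mul (h : IsRealization n_I L k M 0 α γ β_I β_c) :
    γ = ((n_I : ℝ) - 1) * β_I := by
  rw [h.bandwidth_eq, h.cross_eq_zero, repairBandwidth, mul_zero, add_zero]

theorem IsRealization.le_storage (h0 : 2 ≤ n_I) (hk : k ≤ n_I * L)
    (h : IsRealization n_I L k M 0 α γ β_I β_c) : M ≤ ((k - k / n_I : ℕ) : ℝ) * α := by
  have hcap := capacity_le_card_mul (by omega) hk α β_I
  rw [← h.cross_eq_zero, h.capacity_eq, ← ENNReal.ofReal_natCast,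
    ← ENNReal.ofReal_mul (by positivity)] at hcap
  exact (ENNReal.ofReal_le_ofReal_iff (mul_nonneg (by positivity) h.storage_nonneg)).1 hcap

theorem IsRealization.le_intra_add (h0 : 2 ≤ n_I) (hk : k ≤ n_I * L) (hk' : n_I ≤ k + 1)
    (h : IsRealization n_I L k M 0 α γ β_I β_c) :
    M ≤ β_I + ((k - k / n_I - 1 : ℕ) : ℝ) * α := by
  have hmul : 0 ≤ ((k - k / n_I - 1 : ℕ) : ℝ) * α := mul_nonneg (by positivity) h.storage_nonneg
  have hcap := capacity_le_card_mul_add h0 hk hk' α β_I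
  rw [← h.cross_eq_zero, h.capacity_eq, ← ENNReal.ofReal_natCast,
    ← ENNReal.ofReal_mul (by positivity), ← ENNReal.ofReal_add h.intra_pos.le hmul] at hcap
  exact (ENNReal.ofReal_le_ofReal_iff (add_nonneg h.intra_pos.le hmul)).1 hcap

theorem isRealization_self (h0 : 2 ≤ n_I) (hk : k ≤ n_I * L) (hα : 0 < α)
    (hM : ((k - k / n_I : ℕ) : ℝ) * α = M) :
    IsRealization n_I L k M 0 α (α * ((n_I : ℝ) - 1)) α 0 where
  storage_nonneg := hα.le
  intra_pos := hα
  cross_nonneg := le_rfl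
  cross_le_intra := hα.le
  ratio_eq := (zero_div _).symm
  bandwidth_eq := by rw [repairBandwidth, mul_zero, add_zero, mul_comm]
  capacity_eq := by
    rw [← hM, ENNReal.ofReal_mul (by positivity), ENNReal.ofReal_natCast]
    exact (capacity_le_card_mul (by omega) hk α α).antisymm (le_capacity_self (by omega) α)

theorem sub_div_pos (h0 : 2 ≤ n_I) (hk' : n_I ≤ k + 1) : 0 < k - k / n_I :=
  Nat.sub_pos_of_lt (Nat.div_lt_self (by omega) (by omega))

theorem isMSRPoint_self (h0 : 2 ≤ n_I) (hk : k ≤ n_I * L) (hk' : n_I ≤ k + 1) (hα : 0 < α)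
    (hM : ((k - k / n_I : ℕ) : ℝ) * α = M) :
    IsMSRPoint n_I L k M 0 α (α * ((n_I : ℝ) - 1)) where
  feasible := ⟨α, 0, isRealization_self h0 hk hα hM⟩
  storage_min := by
    rintro α' γ' ⟨β, β', h⟩
    have hd : (0 : ℝ) < (k - k / n_I : ℕ) := by exact_mod_cast sub_div_pos h0 hk'
    exact le_of_mul_le_mul_left (hM.le.trans (h.le_storage h0 hk)) hd
  bandwidth_min := by
    rintro γ' ⟨β, β', h⟩
    -- Since `M = d α`, this bound reads `d α ≤ β + (d - 1) α`, that is, `α ≤ β`.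
    have hle := h.le_intra_add h0 hk hk'
    rw [Nat.cast_pred (sub_div_pos h0 hk')] at hle
    have hn : (2 : ℝ) ≤ n_I := by exact_mod_cast h0
    rw [h.bandwidth_eq_mul, mul_comm]
    exact mul_le_mul_of_nonneg_left (by linarith) (by linarith)

theorem IsMSRPoint.unique {ε α' γ' : ℝ} (h : IsMSRPoint n_I L k M ε α γ)
    (h' : IsMSRPoint n_I L k M ε α' γ') : α = α' ∧ γ = γ' := by
  obtain rfl := (h.storage_min _ _ h'.feasible).antisymm (h'.storage_min _ _ h.feasible)
  exact ⟨rfl, (h.bandwidth_min _ h'.feasible).antisymm (h'.bandwidth_min _ h.feasible)⟩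

end MSR

end ClusteredDSS

theorem proposition3 (n k L n_I : ℕ) (hn : n = n_I * L) (hn_I : 2 ≤ n_I) (hkn : k < n)
    (hk : n_I ≤ k + 1) (M : ℝ) (hM : 0 < M) :
    (∀ α γ : ℝ, ClusteredDSS.IsMSRPoint n_I L k M 0 α γ ↔
      (α = M / ((k : ℝ) - ((k / n_I : ℕ) : ℝ)) ∧
        γ = M / ((k : ℝ) - ((k / n_I : ℕ) : ℝ)) * ((n_I : ℝ) - 1))) ∧
    (∀ α γ β_I β_c : ℝ, ClusteredDSS.IsMSRPoint n_I L k M 0 α γ →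
      ClusteredDSS.IsRealization n_I L k M 0 α γ β_I β_c → α = β_I) := by
  have hk_le : k ≤ n_I * L := by omega
  have hd : (0 : ℝ) < (k - k / n_I : ℕ) := by
    exact_mod_cast ClusteredDSS.sub_div_pos hn_I hk
  rw [← Nat.cast_sub (Nat.div_le_self k n_I)]
  have hmsr := ClusteredDSS.isMSRPoint_self hn_I hk_le hk (div_pos hM hd)
    (mul_div_cancel₀ M hd.ne')
  have hiff : ∀ α γ : ℝ, ClusteredDSS.IsMSRPoint n_I L k M 0 α γ ↔
      (α = M / ((k - k / n_I : ℕ) : ℝ) ∧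
        γ = M / ((k - k / n_I : ℕ) : ℝ) * ((n_I : ℝ) - 1)) := fun α γ =>
    ⟨fun h => h.unique hmsr, by rintro ⟨rfl, rfl⟩; exact hmsr⟩
  refine ⟨hiff, fun α γ β_I β_c h hr => ?_⟩
  obtain ⟨rfl, rfl⟩ := (hiff α γ).1 h
  -- As `n_I > 1`, the bandwidth `γ = (n_I - 1) β_I` determines `β_I`.
  have hn1 : (0 : ℝ) < (n_I : ℝ) - 1 := by
    have : (2 : ℝ) ≤ n_I := by exact_mod_cast hn_I
    linarith
  have hbw := hr.bandwidth_eq_mul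
  rw [mul_comm] at hbw
  exact mul_left_cancel₀ hn1.ne' hbw
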